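/- Let $k\in\mathbb N$ and $c\in\mathbb R$ with $1\le c\le \frac{10k}{22}$, and put $\epsilon=\frac1{\log_{2.2}(k/c)}$, $n=2^k$. Let $G=G^{(o)}_{k,c}$ be the weighted graph with vertex set $V=\{0,1\}^k$ in which $x,y$ are adjacent if and only if their Hamming distance $\|x-y\|_1$ is odd, the edge $xy$ having weight $w_{xy}=\epsilon^{\|x-y\|_1}$ (put $w_{xy}=0$ for non-adjacent $x,y$). Let $A=(w_{xy})$ be the adjacency matrix, $d(x)=\sum_y w_{xy}$ the degree, $D$ the diagonal degree matrix, and $\lambda_1\le\dots\le\lambda_n$ the eigenvalues, with multiplicity, of the normalized Laplacian $L=D^{-1/2}(D-A)D^{-1/2}$. For nonempty $T\subseteq V$ let the conductance be $$\phi(T)=\frac{\sum_{x\in T,\,y\notin T}w_{xy}}{\sum_{x\in T}d(x)},$$ and for $T,T'\subseteq V$ with $T\cup T'\ne\emptyset$ let the bipartite conductance be $$\tilde\phi(T,T')=\frac{\sum_{x\in T\cup T',\,y\notin T\cup T'}w_{xy}+2\sum_{e}w_e}{\sum_{x\in T\cup T'}d(x)},$$ where $e$ runs over the edges contained in $T$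 or contained in $T'$. For $S\subseteq\{1,\dots,k\}$ let $W_S(x)=(-1)^{\sum_{i\in S}x_i}$ be the Walsh function, and for $0\le i\le k$ let $$\rho_i=\tfrac12\left((1+\epsilon)^{k-i}(1-\epsilon)^i-(1-\epsilon)^{k-i}(1+\epsilon)^i\right).$$ Then: 1. $G$ is complete bipartite, its sides being the points with an even and with an odd number of ones, and every vertex has degree $d=\frac12\left((1+\epsilon)^k-(1-\epsilon)^k\right)>0$. 2. $AW_S=\rho_{|S|}W_S$ for every $S\subseteq\{1,\dots,k\}$, and $\lambda_1,\dots,\lambda_n$ are, with multiplicity, the $2^k$ numbers $1-\rho_{|S|}/d$, $S\subseteq\{1,\dots,k\}$. 3. $2-\lambda_{n-k}\le 3\epsilon$. 4. $\phi(T)\ge\frac12$ for every nonempty $T\subseteq V$ with $|T|\le\frac ck|V|$. 5. $\tilde\phi(T,T')\ge\frac12$ for all $T,T'\subseteq V$ with $T\cup T'\neq\emptyset$ and $|T\cup T'|\le\frac ck|V|$. 6. (Sharpness: in a bound of the form $\max_i\tilde\phi(T_i,T_i')\le C\sqrt{\log(k)\,(2-\lambda_{n+1-k})}$ for $r=k/4$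 bipartite communities, the factor $\sqrt{\log k}$ cannot be improved by more than a constant.) For every real $c\ge1$ there is $K>0$, depending only on $c$, such that for every $k$ with $c\le\frac{10k}{22}$, every integer $r\ge k/c$, all pairs $(T_1,T_1'),\dots,(T_r,T_r')$ of subsets of $V$ whose unions $T_i\cup T_i'$ are nonempty and pairwise disjoint, and every real $B$: if $\tilde\phi(T_i,T_i')\le B\sqrt{2-\lambda_{n+1-k}}$ in $G^{(o)}_{k,c}$ for all $i$, then $B\ge K\sqrt{\log k}$. -/

import Mathlib

open Finset

/-- A finite weighted undirected graph without loops: edges carry positive weights, and the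
weight is extended by zero to non-adjacent pairs. -/
structure WeightedGraph (V : Type*) where
  graph : SimpleGraph V
  weight : V → V → ℝ
  weight_symm : ∀ x y, weight x y = weight y x
  weight_pos : ∀ x y, graph.Adj x y → 0 < weight x y
  weight_eq_zero : ∀ x y, ¬ graph.Adj x y → weight x y = 0

namespace WeightedGraph

variable {V : Type*} [Fintype V] [DecidableEq V] (G : WeightedGraph V)

/-- The adjacency matrix `A`. -/
def adjMatrix : Matrix V V ℝ := Matrix.of G.weight

/-- The weighted degree `d(x)`. -/
def degree (x : V) : ℝ := ∑ y, G.weight x y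

/-- The diagonal matrix `D^{-1/2}`. -/
noncomputable def invSqrtDegMatrix : Matrix V V ℝ :=
  Matrix.diagonal fun x => (√(G.degree x))⁻¹

/-- The normalized Laplacian `L = D^{-1/2} (D - A) D^{-1/2}`. -/
noncomputable def normLaplacian : Matrix V V ℝ :=
  G.invSqrtDegMatrix * (Matrix.diagonal G.degree - G.adjMatrix) * G.invSqrtDegMatrix

theorem normLaplacian_isHermitian : G.normLaplacian.IsHermitian := by
  have hA : G.adjMatrix.transpose = G.adjMatrix := by
    ext x y
    exact G.weight_symm y x
  unfold Matrix.IsHermitian normLaplacian invSqrtDegMatrix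
  rw [Matrix.conjTranspose_eq_transpose_of_trivial]
  simp [Matrix.transpose_mul, hA, Matrix.mul_assoc]

/-- `G.lam j` is the eigenvalue `λ_j` of the normalized Laplacian, where
`λ_1 ≤ λ_2 ≤ ⋯ ≤ λ_n` are its eigenvalues listed with multiplicity and `n` is the number of
vertices (Mathlib's `eigenvalues₀` lists them in decreasing order, starting at index `0`).
It is only meaningful for `1 ≤ j ≤ n`. -/
noncomputable def lam (j : ℕ) : ℝ :=
  if h : 1 ≤ j ∧ j ≤ Fintype.card V then
    G.normLaplacian_isHermitian.eigenvalues₀ ⟨Fintype.card V - j, by omega⟩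
  else 0

/-- `‖C(S)‖`: total weight of the stubs (half edges) at vertices of `S`. -/
def stubWeight (S : Finset V) : ℝ := ∑ x ∈ S, G.degree x

/-- `‖B(S)‖`: total weight of the stubs at vertices of `S` whose other end is outside `S`. -/
def boundaryWeight (S : Finset V) : ℝ := ∑ x ∈ S, ∑ y ∈ Sᶜ, G.weight x y

/-- `‖B'(S,S')‖`: twice the total weight of the edges contained in `S` or contained in `S'`.
Summing over ordered pairs counts every such edge exactly twice. -/
def insideWeight (S S' : Finset V) : ℝ :=
  ∑ x, ∑ y, if (x ∈ S ∧ y ∈ S) ∨ (x ∈ S' ∧ y ∈ S') then G.weight x y else 0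

/-- The conductance `φ(S) = ‖B(S)‖ / ‖C(S)‖`. -/
noncomputable def conductance (S : Finset V) : ℝ := G.boundaryWeight S / G.stubWeight S

/-- The bipartite conductance `φ̃(S,S') = (‖B(S ∪ S')‖ + ‖B'(S,S')‖) / ‖C(S ∪ S')‖`. -/
noncomputable def bipartiteConductance (S S' : Finset V) : ℝ :=
  (G.boundaryWeight (S ∪ S') + G.insideWeight S S') / G.stubWeight (S ∪ S')

end WeightedGraph

/-- The noise parameter `ε = 1 / log_{2.2} (k / c)`. -/
noncomputable def noise (k : ℕ) (c : ℝ) : ℝ := 1 / Real.logb 2.2 (k / c)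

theorem noise_pos {k : ℕ} {c : ℝ} (h1 : 1 ≤ c) (h2 : c ≤ 10 * k / 22) : 0 < noise k c := by
  have hc : (0 : ℝ) < c := by linarith
  have h : (1 : ℝ) < k / c := by
    rw [lt_div_iff₀ hc]
    linarith
  exact one_div_pos.mpr (Real.logb_pos (by norm_num) h)

open Classical in
/-- The bipartite noisy hypercube `G^{(o)}_{k,c}` on `{0,1}^k`: `x` and `y` are adjacent exactly
when their Hamming distance `‖x - y‖₁` is odd, and then the edge has weight `ε ^ ‖x - y‖₁`. -/
noncomputable def bipartiteNoisyHypercube (k : ℕ) (c : ℝ) (h1 : 1 ≤ c) (h2 : c ≤ 10 * k / 22) :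
    WeightedGraph (Fin k → Fin 2) where
  graph :=
    { Adj := fun x y => Odd (hammingDist x y)
      symm := ⟨fun x y h => by rwa [hammingDist_comm]⟩
      loopless := ⟨fun x h => by simp at h⟩ }
  weight x y := if Odd (hammingDist x y) then noise k c ^ hammingDist x y else 0
  weight_symm x y := by rw [hammingDist_comm]
  weight_pos x y h := by
    have h' : Odd (hammingDist x y) := h
    rw [if_pos h']
    exact pow_pos (noise_pos h1 h2) _
  weight_eq_zero x y h := if_neg h

/-- The Walsh function `W_S(x) = (-1)^{∑_{i ∈ S} x_i}`. -/
def walsh {k : ℕ} (S : Finset (Fin k)) (x : Fin k → Fin 2) : ℝ :=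
  (-1) ^ (∑ i ∈ S, (x i : ℕ))

/-- `ρ_i = ((1+ε)^{k-i} (1-ε)^i - (1-ε)^{k-i} (1+ε)^i) / 2`, for `0 ≤ i ≤ k`. -/
noncomputable def walshEigenvalue (k : ℕ) (ε : ℝ) (i : ℕ) : ℝ :=
  ((1 + ε) ^ (k - i) * (1 - ε) ^ i - (1 - ε) ^ (k - i) * (1 + ε) ^ i) / 2

/-! The weight is the odd part in `ε` of the kernel `ε ^ ‖x - y‖₁`, that is, half the difference of
the product kernels with parameters `ε` and `-ε`. Walsh functions diagonalize both product kernels,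
so they give the whole spectrum. The sets with at least `k - 1` elements, `k + 1` of them, produce
Laplacian eigenvalues that are at least `2 - 3ε`.

For the conductance, the weight inside `T` has to be at most half of `d * |T|`. The kernel with
parameter `-ε` is positive semidefinite, so dropping it only enlarges the bound. The kernel with
parameter `ε` is `(1 + ε) ^ k` times a noise operator, and hypercontractivity (`noiseForm_rpow_le`,
tensorized from `two_point`) bounds its sum over `T × T` by `(1 + ε) ^ k * |T| * (|T| / 2 ^ k) ^ ε`.
The choice of `ε` makes `(c / k) ^ ε = 1 / 2.2`, and `kε ≥ 2` makes `(1 - ε) ^ k` small enough in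
`d` for the factor `1 / 2` to come out.

The bipartite conductance dominates the conductance of the union. Sharpness follows because among at
least `k / c` disjoint unions one is small, while `2 - λ_{n+1-k} ≤ 3ε` is of order at most `1 / log
k` for fixed `c`. -/

/-! ### Bonami's two-point inequality. -/

/-- The second-order lower bound for the even part of `(1 + y) ^ p`. -/
theorem one_add_mul_sq_le_rpow_even_part {p y : ℝ} (hp1 : 1 ≤ p) (hp2 : p ≤ 2) (hy0 : 0 ≤ y)
    (hy1 : y ≤ 1) :
    1 + p * (p - 1) / 2 * y ^ 2 ≤ ((1 + y) ^ p + (1 - y) ^ p) / 2 := by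
  have hder : ∀ (s z : ℝ), 0 < z → z < 1 →
      HasDerivAt (fun t : ℝ => (1 + t) ^ s) (s * (1 + z) ^ (s - 1)) z ∧
      HasDerivAt (fun t : ℝ => (1 - t) ^ s) (-(s * (1 - z) ^ (s - 1))) z := by
    intro s z h0 h1
    constructor
    · have := ((hasDerivAt_id z).const_add 1).rpow_const (p := s) (Or.inl (by simp; linarith))
      simpa using this
    · have := ((hasDerivAt_id z).const_sub 1).rpow_const (p := s)
        (Or.inl (by simp; linarith))
      simpa using this
  have hcont : ∀ s : ℝ, 0 ≤ s → Continuous (fun t : ℝ => (1 + t) ^ s) ∧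
      Continuous (fun t : ℝ => (1 - t) ^ s) := by
    intro s hs
    exact ⟨(by fun_prop : Continuous fun t : ℝ => 1 + t).rpow_const fun _ => Or.inr hs,
      (by fun_prop : Continuous fun t : ℝ => 1 - t).rpow_const fun _ => Or.inr hs⟩
  have hmem : ∀ z, z ∈ interior (Set.Icc (0 : ℝ) 1) → 0 < z ∧ z < 1 := by
    intro z hz
    rwa [interior_Icc] at hz
  have first : ∀ z : ℝ, 0 ≤ z → z ≤ 1 →
      0 ≤ (1 + z) ^ (p - 1) - (1 - z) ^ (p - 1) - 2 * (p - 1) * z := by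
    have hmono : MonotoneOn
        (fun z : ℝ => (1 + z) ^ (p - 1) - (1 - z) ^ (p - 1) - 2 * (p - 1) * z) (Set.Icc 0 1) := by
      have hd : ∀ z ∈ interior (Set.Icc (0 : ℝ) 1), HasDerivAt
          (fun z : ℝ => (1 + z) ^ (p - 1) - (1 - z) ^ (p - 1) - 2 * (p - 1) * z)
          ((p - 1) * ((1 + z) ^ (p - 1 - 1) + (1 - z) ^ (p - 1 - 1) - 2)) z := by
        intro z hz
        obtain ⟨h0, h1⟩ := hmem z hz
        obtain ⟨e1, e2⟩ := hder (p - 1) z h0 h1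
        exact ((e1.sub e2).sub ((hasDerivAt_id z).const_mul (2 * (p - 1)))).congr_deriv (by ring)
      refine monotoneOn_of_deriv_nonneg (convex_Icc 0 1) ?_ ?_ ?_
      · obtain ⟨c1, c2⟩ := hcont (p - 1) (by linarith)
        exact ((c1.sub c2).sub (by fun_prop)).continuousOn
      · exact fun z hz => (hd z hz).differentiableAt.differentiableWithinAt
      · intro z hz
        rw [(hd z hz).deriv]
        obtain ⟨h0, h1⟩ := hmem z hz
        refine mul_nonneg (by linarith) ?_
        have hA : 0 < (1 + z) ^ (p - 1 - 1) := Real.rpow_pos_of_pos (by linarith) _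
        have hB : 0 < (1 - z) ^ (p - 1 - 1) := Real.rpow_pos_of_pos (by linarith) _
        -- The product is `(1 - z ^ 2) ^ (p - 2)` with `p - 2 ≤ 0`. By AM-GM the sum of the two
        -- powers is then at least 2.
        have hAB : 1 ≤ (1 + z) ^ (p - 1 - 1) * (1 - z) ^ (p - 1 - 1) := by
          rw [← Real.mul_rpow (by linarith) (by linarith)]
          exact Real.one_le_rpow_of_pos_of_le_one_of_nonpos (by nlinarith) (by nlinarith)
            (by linarith)
        nlinarith [sq_nonneg ((1 + z) ^ (p - 1 - 1) - (1 - z) ^ (p - 1 - 1))]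
    intro z h0 h1
    have := hmono (Set.left_mem_Icc.2 zero_le_one) ⟨h0, h1⟩ h0
    simpa using this
  have hmono : MonotoneOn
      (fun z : ℝ => (1 + z) ^ p + (1 - z) ^ p - p * (p - 1) * z ^ 2) (Set.Icc 0 1) := by
    have hd : ∀ z ∈ interior (Set.Icc (0 : ℝ) 1), HasDerivAt
        (fun z : ℝ => (1 + z) ^ p + (1 - z) ^ p - p * (p - 1) * z ^ 2)
        (p * ((1 + z) ^ (p - 1) - (1 - z) ^ (p - 1) - 2 * (p - 1) * z)) z := by
      intro z hz
      obtain ⟨h0, h1⟩ := hmem z hz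
      obtain ⟨e1, e2⟩ := hder p z h0 h1
      exact ((e1.add e2).sub (((hasDerivAt_id z).pow 2).const_mul (p * (p - 1)))).congr_deriv
        (by simp only [id]; push_cast; ring)
    refine monotoneOn_of_deriv_nonneg (convex_Icc 0 1) ?_ ?_ ?_
    · obtain ⟨c1, c2⟩ := hcont p (by linarith)
      exact ((c1.add c2).sub (by fun_prop)).continuousOn
    · exact fun z hz => (hd z hz).differentiableAt.differentiableWithinAt
    · intro z hz
      rw [(hd z hz).deriv]
      obtain ⟨h0, h1⟩ := hmem z hz
      exact mul_nonneg (by linarith) (first z h0.le h1.le)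
  have := hmono (Set.left_mem_Icc.2 zero_le_one) ⟨hy0, hy1⟩ hy0
  norm_num at this
  linarith

/-- The two-point inequality of Bonami, in normalized form. -/
theorem two_point_normalized {p y : ℝ} (hp1 : 1 ≤ p) (hp2 : p ≤ 2) (hy0 : 0 ≤ y) (hy1 : y ≤ 1) :
    1 + (p - 1) * y ^ 2 ≤ (((1 + y) ^ p + (1 - y) ^ p) / 2) ^ (2 / p) := by
  -- Bernoulli's inequality for the exponent `p / 2 ≤ 1`; the right side is exactly the second-order
  -- bound.
  have hb : (1 + (p - 1) * y ^ 2) ^ (p / 2) ≤ 1 + p / 2 * ((p - 1) * y ^ 2) :=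
    rpow_one_add_le_one_add_mul_self (by nlinarith [sq_nonneg y]) (by linarith) (by linarith)
  have h0 : 0 ≤ 1 + (p - 1) * y ^ 2 := by nlinarith [sq_nonneg y]
  have h := one_add_mul_sq_le_rpow_even_part hp1 hp2 hy0 hy1
  calc 1 + (p - 1) * y ^ 2 = ((1 + (p - 1) * y ^ 2) ^ (p / 2)) ^ (2 / p) := by
        rw [← Real.rpow_mul h0, show p / 2 * (2 / p) = 1 by field_simp, Real.rpow_one]
    _ ≤ _ := Real.rpow_le_rpow (Real.rpow_nonneg h0 _) (by linarith) (by positivity)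

/-- The two-point inequality of Bonami. -/
theorem two_point {e u v : ℝ} (he0 : 0 ≤ e) (he1 : e ≤ 1) (hu : 0 ≤ u) (hv : 0 ≤ v) :
    (u ^ ((1 + e) / 2)) ^ 2 + (v ^ ((1 + e) / 2)) ^ 2
        + 2 * e * (u ^ ((1 + e) / 2) * v ^ ((1 + e) / 2)) ≤
      (1 + e) * 2 ^ (-e) * (u + v) ^ (1 + e) := by
  wlog huv : v ≤ u generalizing u v
  · have := this hv hu (le_of_not_ge huv)
    rw [add_comm u v]
    linarith
  rcases hu.eq_or_lt with rfl | hu'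
  · obtain rfl : v = 0 := le_antisymm huv hv
    rw [Real.zero_rpow (by positivity), add_zero, Real.zero_rpow (by positivity)]
    simp
  set q := (1 + e) / 2 with hq
  have hq0 : 0 < q := by positivity
  set a := u ^ q with ha
  set b := v ^ q with hb
  have ha0 : 0 < a := Real.rpow_pos_of_pos hu' _
  have hb0 : 0 ≤ b := Real.rpow_nonneg hv _
  have hab : b ≤ a := Real.rpow_le_rpow hv huv hq0.le
  -- With `p = 1 / q = 2 / (1 + e)`, the inequality becomes the normalized one after writing `a =
  -- m(1 + y)`, `b = m(1 - y)`; the match rests on `p - 1 = (1 - e) / (1 + e)`.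
  have hua : u = a ^ (1 / q) := by
    rw [ha, ← Real.rpow_mul hu, mul_one_div_cancel hq0.ne', Real.rpow_one]
  have hvb : v = b ^ (1 / q) := by
    rw [hb, ← Real.rpow_mul hv, mul_one_div_cancel hq0.ne', Real.rpow_one]
  set m := (a + b) / 2 with hm
  have hm0 : 0 < m := by positivity
  set y := (a - b) / (a + b) with hy
  have hy0 : 0 ≤ y := div_nonneg (by linarith) (by linarith)
  have hy1 : y ≤ 1 := by rw [hy, div_le_one (by linarith)]; linarith
  have ham : a = m * (1 + y) := by rw [hm, hy]; field_simp; ring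
  have hbm : b = m * (1 - y) := by rw [hm, hy]; field_simp; ring
  have hp1 : 1 ≤ 1 / q := by rw [le_div_iff₀ hq0, hq]; linarith
  have hp2 : 1 / q ≤ 2 := by rw [div_le_iff₀ hq0, hq]; linarith
  have key := two_point_normalized hp1 hp2 hy0 hy1
  have h2q : 2 / (1 / q) = 1 + e := by rw [hq]; field_simp
  rw [h2q] at key
  set s := ((1 + y) ^ (1 / q) + (1 - y) ^ (1 / q)) / 2 with hs
  have hs0 : 0 ≤ s :=
    div_nonneg (add_nonneg (Real.rpow_nonneg (by linarith) _) (Real.rpow_nonneg (by linarith) _))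
      (by norm_num)
  have huv' : u + v = m ^ (1 / q) * 2 * s := by
    rw [hua, hvb, ham, hbm, Real.mul_rpow hm0.le (by linarith),
      Real.mul_rpow hm0.le (by linarith), hs]
    ring
  have hmq : (m ^ (1 / q)) ^ (1 + e) = m ^ 2 := by
    rw [← Real.rpow_mul hm0.le, show 1 / q * (1 + e) = 2 by rw [hq]; field_simp]
    norm_cast
  have h2 : (2 : ℝ) ^ (-e) * 2 ^ (1 + e) = 2 := by
    rw [← Real.rpow_add two_pos]; norm_num
  have hpq : (1 + e) * (1 / q - 1) = 1 - e := by
    rw [hq]; field_simp; ring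
  calc a ^ 2 + b ^ 2 + 2 * e * (a * b)
      = 2 * m ^ 2 * ((1 + e) + (1 - e) * y ^ 2) := by rw [ham, hbm]; ring
    _ = 2 * m ^ 2 * (1 + e) * (1 + (1 / q - 1) * y ^ 2) := by rw [← hpq]; ring
    _ ≤ 2 * m ^ 2 * (1 + e) * s ^ (1 + e) := by gcongr
    _ = (1 + e) * 2 ^ (-e) * (u + v) ^ (1 + e) := by
      rw [huv', Real.mul_rpow (by positivity) hs0, Real.mul_rpow (by positivity) (by norm_num),
        hmq]
      linear_combination (-(1 + e) * m ^ 2 * s ^ (1 + e)) * h2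

/-- The two-point inequality of Bonami in two-function form. -/
theorem two_point_bilinear {e u v w z : ℝ} (he0 : 0 ≤ e) (he1 : e ≤ 1) (hu : 0 ≤ u) (hv : 0 ≤ v)
    (hw : 0 ≤ w) (hz : 0 ≤ z) :
    u ^ ((1 + e) / 2) * w ^ ((1 + e) / 2) + v ^ ((1 + e) / 2) * z ^ ((1 + e) / 2)
        + e * (u ^ ((1 + e) / 2) * z ^ ((1 + e) / 2) + v ^ ((1 + e) / 2) * w ^ ((1 + e) / 2)) ≤
      (1 + e) * 2 ^ (-e) * ((u + v) ^ ((1 + e) / 2) * (w + z) ^ ((1 + e) / 2)) := by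
  have h1 := two_point he0 he1 hu hv
  have h2 := two_point he0 he1 hw hz
  have hsq : ∀ t : ℝ, 0 ≤ t → t ^ (1 + e) = (t ^ ((1 + e) / 2)) ^ 2 := by
    intro t ht
    rw [← Real.rpow_natCast, ← Real.rpow_mul ht]
    congr 1
    push_cast
    ring
  rw [hsq _ (by positivity)] at h1 h2
  have ha := Real.rpow_nonneg hu ((1 + e) / 2)
  have hb := Real.rpow_nonneg hv ((1 + e) / 2)
  have hc := Real.rpow_nonneg hw ((1 + e) / 2)
  have hd := Real.rpow_nonneg hz ((1 + e) / 2)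
  have hU := Real.rpow_nonneg (add_nonneg hu hv) ((1 + e) / 2)
  have hW := Real.rpow_nonneg (add_nonneg hw hz) ((1 + e) / 2)
  have hC : 0 ≤ (1 + e) * (2 : ℝ) ^ (-e) := by positivity
  generalize (1 + e) * (2 : ℝ) ^ (-e) = C at *
  generalize u ^ ((1 + e) / 2) = a at *
  generalize v ^ ((1 + e) / 2) = b at *
  generalize w ^ ((1 + e) / 2) = c at *
  generalize z ^ ((1 + e) / 2) = d at *
  generalize (u + v) ^ ((1 + e) / 2) = U at *
  generalize (w + z) ^ ((1 + e) / 2) = W at *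
  -- Cauchy-Schwarz for the quadratic form `a ^ 2 + b ^ 2 + 2 * e * a * b`, which is positive
  -- semidefinite because `e ≤ 1`.
  have hcs : (a * c + b * d + e * (a * d + b * c)) ^ 2 ≤
      (a ^ 2 + b ^ 2 + 2 * e * (a * b)) * (c ^ 2 + d ^ 2 + 2 * e * (c * d)) := by
    have : (a ^ 2 + b ^ 2 + 2 * e * (a * b)) * (c ^ 2 + d ^ 2 + 2 * e * (c * d))
        - (a * c + b * d + e * (a * d + b * c)) ^ 2 = (1 - e ^ 2) * (a * d - b * c) ^ 2 := by ring
    have h' : 0 ≤ (1 - e ^ 2) * (a * d - b * c) ^ 2 := mul_nonneg (by nlinarith) (sq_nonneg _)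
    linarith
  refine abs_le_of_sq_le_sq' ?_ (by positivity) |>.2
  calc _ ≤ _ := hcs
    _ ≤ (C * U ^ 2) * (C * W ^ 2) := by gcongr
    _ = _ := by ring

/-! ### The noise form on the cube: positivity and hypercontractivity. -/

theorem sum_fin_succ_cube {k : ℕ} (F : (Fin (k + 1) → Fin 2) → ℝ) :
    ∑ x, F x = (∑ x : Fin k → Fin 2, F (Fin.cons 0 x)) + ∑ x : Fin k → Fin 2, F (Fin.cons 1 x) := by
  rw [← (Fin.consEquiv fun _ => Fin 2).sum_comp, Fintype.sum_prod_type, Fin.sum_univ_two]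
  rfl

theorem hammingDist_cons {k : ℕ} (a b : Fin 2) (x y : Fin k → Fin 2) :
    hammingDist (Fin.cons a x : Fin (k + 1) → Fin 2) (Fin.cons b y : Fin (k + 1) → Fin 2) =
      (if a ≠ b then 1 else 0) + hammingDist x y := by
  simp only [hammingDist, Finset.card_filter, Fin.sum_univ_succ, Fin.cons_zero, Fin.cons_succ]

/-- The bilinear form with kernel `t ^ ‖x - y‖₁` on functions on the cube. -/
def noiseForm {k : ℕ} (t : ℝ) (f g : (Fin k → Fin 2) → ℝ) : ℝ :=
  ∑ x, ∑ y, f x * g y * t ^ hammingDist x y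

theorem noiseForm_succ {k : ℕ} (t : ℝ) (f g : (Fin (k + 1) → Fin 2) → ℝ) :
    noiseForm t f g =
      noiseForm t (fun x => f (Fin.cons 0 x)) (fun x => g (Fin.cons 0 x)) +
      noiseForm t (fun x => f (Fin.cons 1 x)) (fun x => g (Fin.cons 1 x)) +
      t * (noiseForm t (fun x => f (Fin.cons 0 x)) (fun x => g (Fin.cons 1 x)) +
        noiseForm t (fun x => f (Fin.cons 1 x)) (fun x => g (Fin.cons 0 x))) := by
  simp only [noiseForm, sum_fin_succ_cube, hammingDist_cons, Finset.sum_add_distrib, mul_add,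
    Finset.mul_sum]
  have e1 : ∀ (a b c : ℝ) (n : ℕ), a * b * c ^ (1 + n) = c * (a * b * c ^ n) := by
    intros; ring
  simp [e1]
  ring

theorem noiseForm_add_left {k : ℕ} (t : ℝ) (f f' g : (Fin k → Fin 2) → ℝ) :
    noiseForm t (f + f') g = noiseForm t f g + noiseForm t f' g := by
  simp [noiseForm, add_mul, Finset.sum_add_distrib]

theorem noiseForm_sub_left {k : ℕ} (t : ℝ) (f f' g : (Fin k → Fin 2) → ℝ) :
    noiseForm t (f - f') g = noiseForm t f g - noiseForm t f' g := by
  simp [noiseForm, sub_mul, Finset.sum_sub_distrib]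

theorem noiseForm_add_right {k : ℕ} (t : ℝ) (f g g' : (Fin k → Fin 2) → ℝ) :
    noiseForm t f (g + g') = noiseForm t f g + noiseForm t f g' := by
  simp [noiseForm, add_mul, mul_add, Finset.sum_add_distrib]

theorem noiseForm_sub_right {k : ℕ} (t : ℝ) (f g g' : (Fin k → Fin 2) → ℝ) :
    noiseForm t f (g - g') = noiseForm t f g - noiseForm t f g' := by
  simp [noiseForm, sub_mul, mul_sub, Finset.sum_sub_distrib]

/-- Splitting off one coordinate diagonalizes the form: it equals `(1 + t) / 2` times the form at
`f0 + f1` plus `(1 - t) / 2` times the form at `f0 - f1`. -/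
theorem noiseForm_self_nonneg {t : ℝ} (h1 : -1 ≤ t) (h2 : t ≤ 1) {k : ℕ}
    (f : (Fin k → Fin 2) → ℝ) : 0 ≤ noiseForm t f f := by
  induction k with
  | zero =>
    simp [noiseForm, hammingDist]
    exact mul_self_nonneg _
  | succ k ih =>
    rw [noiseForm_succ]
    set f0 : (Fin k → Fin 2) → ℝ := fun x => f (Fin.cons 0 x)
    set f1 : (Fin k → Fin 2) → ℝ := fun x => f (Fin.cons 1 x)
    have hp := mul_nonneg (by linarith : 0 ≤ (1 + t) / 2) (ih (f0 + f1))
    have hm := mul_nonneg (by linarith : 0 ≤ (1 - t) / 2) (ih (f0 - f1))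
    simp only [noiseForm_add_left, noiseForm_add_right, noiseForm_sub_left,
      noiseForm_sub_right] at hp hm
    linarith

/-- Hypercontractivity of the noise operator in two-function form. -/
theorem noiseForm_rpow_le {e : ℝ} (he0 : 0 ≤ e) (he1 : e ≤ 1) {k : ℕ}
    (f g : (Fin k → Fin 2) → ℝ) (hf : ∀ x, 0 ≤ f x) (hg : ∀ x, 0 ≤ g x) :
    noiseForm e (fun x => f x ^ ((1 + e) / 2)) (fun x => g x ^ ((1 + e) / 2)) ≤
      ((1 + e) * 2 ^ (-e)) ^ k * ((∑ x, f x) ^ ((1 + e) / 2) * (∑ x, g x) ^ ((1 + e) / 2)) := by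
  induction k with
  | zero => simp [noiseForm, hammingDist]
  | succ k ih =>
    rw [noiseForm_succ, sum_fin_succ_cube, sum_fin_succ_cube g]
    have i00 := ih (fun x => f (Fin.cons 0 x)) (fun x => g (Fin.cons 0 x)) (fun _ => hf _)
      fun _ => hg _
    have i01 := ih (fun x => f (Fin.cons 0 x)) (fun x => g (Fin.cons 1 x)) (fun _ => hf _)
      fun _ => hg _
    have i10 := ih (fun x => f (Fin.cons 1 x)) (fun x => g (Fin.cons 0 x)) (fun _ => hf _)
      fun _ => hg _
    have i11 := ih (fun x => f (Fin.cons 1 x)) (fun x => g (Fin.cons 1 x)) (fun _ => hf _)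
      fun _ => hg _
    have hC : 0 ≤ ((1 + e) * (2 : ℝ) ^ (-e)) ^ k := by positivity
    -- Tensorization: the induction hypothesis bounds the four pairs of slices, and the two-point
    -- inequality, applied to the sums over the slices, recombines them.
    have h2 := mul_le_mul_of_nonneg_left (two_point_bilinear he0 he1
      (Finset.sum_nonneg fun x _ => hf (Fin.cons 0 x) :
        0 ≤ ∑ x : Fin k → Fin 2, f (Fin.cons 0 x))
      (Finset.sum_nonneg fun x _ => hf (Fin.cons 1 x) :
        0 ≤ ∑ x : Fin k → Fin 2, f (Fin.cons 1 x))
      (Finset.sum_nonneg fun x _ => hg (Fin.cons 0 x) :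
        0 ≤ ∑ x : Fin k → Fin 2, g (Fin.cons 0 x))
      (Finset.sum_nonneg fun x _ => hg (Fin.cons 1 x) :
        0 ≤ ∑ x : Fin k → Fin 2, g (Fin.cons 1 x))) hC
    have h3 := mul_le_mul_of_nonneg_left (add_le_add i01 i10) he0
    rw [pow_succ]
    linarith

/-- The small-set bound for the noise form. -/
theorem noiseForm_indicator_le {e : ℝ} (he0 : 0 ≤ e) (he1 : e ≤ 1) {k : ℕ}
    (T : Finset (Fin k → Fin 2)) :
    ∑ x ∈ T, ∑ y ∈ T, e ^ hammingDist x y ≤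
      ((1 + e) * 2 ^ (-e)) ^ k * (T.card : ℝ) ^ (1 + e) := by
  have h := noiseForm_rpow_le he0 he1 (fun x => if x ∈ T then (1 : ℝ) else 0)
    (fun x => if x ∈ T then (1 : ℝ) else 0) (fun x => by positivity) (fun x => by positivity)
  have hi : ∀ x, (if x ∈ T then (1 : ℝ) else 0) ^ ((1 + e) / 2) = if x ∈ T then 1 else 0 := by
    intro x
    split_ifs
    · simp
    · exact Real.zero_rpow (by positivity)
  simp only [hi] at h
  have hs : ∑ x, (if x ∈ T then (1 : ℝ) else 0) = T.card := by simp
  rw [hs] at h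
  have hpow : (T.card : ℝ) ^ ((1 + e) / 2) * (T.card : ℝ) ^ ((1 + e) / 2) =
      (T.card : ℝ) ^ (1 + e) := by
    rw [← Real.rpow_add_of_nonneg (by positivity) (by positivity) (by positivity)]
    congr 1
    ring
  rw [hpow] at h
  refine le_trans (le_of_eq ?_) h
  simp [noiseForm, Finset.sum_ite_mem, ite_mul, mul_ite]

theorem noiseForm_neg_indicator_nonneg {e : ℝ} (he0 : 0 ≤ e) (he1 : e ≤ 1) {k : ℕ}
    (T : Finset (Fin k → Fin 2)) :
    0 ≤ ∑ x ∈ T, ∑ y ∈ T, (-e) ^ hammingDist x y := by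
  have h := noiseForm_self_nonneg (t := -e) (by linarith) (by linarith)
    (fun x => if x ∈ T then (1 : ℝ) else 0)
  refine le_trans h (le_of_eq ?_)
  simp [noiseForm, Finset.sum_ite_mem, ite_mul, mul_ite]

/-! ### Walsh functions and spectra with multiplicity. -/

/-- Walsh functions are eigenfunctions of the kernel `t ^ ‖x - y‖₁`. -/
theorem sum_pow_hammingDist_mul_walsh {k : ℕ} (t : ℝ) (S : Finset (Fin k)) (x : Fin k → Fin 2) :
    ∑ y, t ^ hammingDist x y * walsh S y =
      (1 + t) ^ (k - S.card) * (1 - t) ^ S.card * walsh S x := by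
  have hw : ∀ z : Fin k → Fin 2, walsh S z = ∏ i, if i ∈ S then (-1 : ℝ) ^ (z i : ℕ) else 1 := by
    intro z
    rw [walsh, ← Finset.prod_pow_eq_pow_sum, Finset.prod_ite_mem, Finset.univ_inter]
  have ht : ∀ y, t ^ hammingDist x y = ∏ i, if x i ≠ y i then t else 1 := by
    intro y
    rw [hammingDist, Finset.prod_ite, Finset.prod_const, Finset.prod_const_one, mul_one]
  have hloc : ∀ i, ∑ b : Fin 2, (if x i ≠ b then t else 1) *
      (if i ∈ S then (-1 : ℝ) ^ (b : ℕ) else 1) =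
      (if i ∈ S then 1 - t else 1 + t) * if i ∈ S then (-1 : ℝ) ^ (x i : ℕ) else 1 := by
    intro i
    generalize x i = a
    fin_cases a <;> by_cases hi : i ∈ S <;> simp [hi] <;> ring
  have hc : ∏ i, (if i ∈ S then 1 - t else 1 + t) = (1 + t) ^ (k - S.card) * (1 - t) ^ S.card := by
    rw [Finset.prod_ite, Finset.prod_const, Finset.prod_const, mul_comm]
    congr 2
    · rw [Finset.filter_not, Finset.card_sdiff_of_subset (Finset.filter_subset _ _)]
      simp
    · simp
  simp_rw [hw, ht, ← Finset.prod_mul_distrib]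
  rw [← hc, ← Finset.prod_mul_distrib, ← Finset.prod_congr rfl fun i _ => hloc i,
    Finset.prod_univ_sum, Fintype.piFinset_univ]

/-- The sum factors over the coordinates; a coordinate lying in exactly one of the two sets
contributes `1 + (-1) = 0`. -/
theorem sum_walsh_mul_walsh {k : ℕ} {S T : Finset (Fin k)} (h : S ≠ T) :
    ∑ x, walsh S x * walsh T x = 0 := by
  have hw : ∀ (S : Finset (Fin k)) (z : Fin k → Fin 2),
      walsh S z = ∏ i, if i ∈ S then (-1 : ℝ) ^ (z i : ℕ) else 1 := by
    intro S z
    rw [walsh, ← Finset.prod_pow_eq_pow_sum, Finset.prod_ite_mem, Finset.univ_inter]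
  simp_rw [hw, ← Finset.prod_mul_distrib]
  have := Finset.prod_univ_sum (fun _ : Fin k => (Finset.univ : Finset (Fin 2)))
    (fun i b => (if i ∈ S then (-1 : ℝ) ^ (b : ℕ) else 1) * if i ∈ T then (-1) ^ (b : ℕ) else 1)
  rw [Fintype.piFinset_univ] at this
  rw [← this]
  obtain ⟨i, hi⟩ : ∃ i, ¬ (i ∈ S ↔ i ∈ T) := by
    by_contra! hc
    exact h (Finset.ext hc)
  refine Finset.prod_eq_zero (Finset.mem_univ i) ?_
  by_cases h1 : i ∈ S <;> by_cases h2 : i ∈ T <;> simp_all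

theorem walsh_mul_self {k : ℕ} (S : Finset (Fin k)) (x : Fin k → Fin 2) :
    walsh S x * walsh S x = 1 := by
  rw [walsh, ← mul_pow]
  simp

theorem linearIndependent_walsh (k : ℕ) :
    LinearIndependent ℝ (walsh : Finset (Fin k) → (Fin k → Fin 2) → ℝ) := by
  rw [Fintype.linearIndependent_iff]
  intro g hg T
  have h : ∑ x, (∑ S, g S • walsh S) x * walsh T x = 0 := by rw [hg]; simp
  simp only [Finset.sum_apply, Pi.smul_apply, smul_eq_mul, Finset.sum_mul] at h
  rw [Finset.sum_comm, Finset.sum_eq_single T] at h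
  · simpa [mul_assoc, walsh_mul_self] using h
  · intro S _ hS
    simp_rw [mul_assoc]
    rw [← Finset.mul_sum, sum_walsh_mul_walsh hS, mul_zero]
  · simp

/-- The Walsh basis of the space of functions on the cube. -/
noncomputable def walshBasis (k : ℕ) :
    Module.Basis (Finset (Fin k)) ℝ ((Fin k → Fin 2) → ℝ) :=
  basisOfLinearIndependentOfCardEqFinrank (linearIndependent_walsh k) (by simp)

/-- A matrix with the Walsh functions as eigenvectors has the corresponding eigenvalues as the
roots of its characteristic polynomial. -/
theorem roots_charpoly_of_walsh {k : ℕ} (M : Matrix (Fin k → Fin 2) (Fin k → Fin 2) ℝ)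
    (μ : Finset (Fin k) → ℝ) (h : ∀ S, M.mulVec (walsh S) = μ S • walsh S) :
    M.charpoly.roots = (Finset.univ : Finset (Finset (Fin k))).val.map μ := by
  have hb : ∀ S, walshBasis k S = walsh S := by simp [walshBasis]
  -- The characteristic polynomial does not depend on the basis, and in the Walsh basis the matrix
  -- is diagonal.
  have hd : LinearMap.toMatrix (walshBasis k) (walshBasis k) M.toLin' = Matrix.diagonal μ := by
    ext S T
    rw [LinearMap.toMatrix_apply, Matrix.toLin'_apply, hb, h, ← hb, map_smul,
      Module.Basis.repr_self, Finsupp.smul_single, Finsupp.single_apply, Matrix.diagonal_apply]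
    by_cases hST : S = T
    · simp [hST]
    · simp [hST, Ne.symm hST]
  rw [← Matrix.charpoly_toLin', ← LinearMap.charpoly_toMatrix M.toLin' (walshBasis k), hd,
    Matrix.charpoly_diagonal, ← Finset.prod_map_val,
    ← Polynomial.roots_multiset_prod_X_sub_C (Finset.univ.val.map μ), Multiset.map_map]
  rfl

/-- The reindexing `j ↦ n - j` turns the increasing list starting at 1 into the decreasing list
starting at 0. -/
theorem WeightedGraph.map_lam {V : Type*} [Fintype V] [DecidableEq V] (G : WeightedGraph V) :
    (Finset.Icc 1 (Fintype.card V)).val.map G.lam = G.normLaplacian.charpoly.roots := by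
  rw [G.normLaplacian_isHermitian.roots_charpoly_eq_eigenvalues₀]
  refine Multiset.map_eq_map_of_bij_of_nodup _ _ (Finset.nodup _) (Finset.nodup _)
    (fun j hj => ⟨Fintype.card V - j, by
      have := Finset.mem_Icc.1 (Finset.mem_def.2 hj); omega⟩) ?_ ?_ ?_ ?_
  · intro j hj
    simp
  · intro i hi j hj hij
    have := Finset.mem_Icc.1 (Finset.mem_def.2 hi)
    have := Finset.mem_Icc.1 (Finset.mem_def.2 hj)
    simp only [Fin.mk.injEq] at hij
    omega
  · intro i _
    refine ⟨Fintype.card V - i, ?_, ?_⟩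
    · rw [← Finset.mem_def, Finset.mem_Icc]; omega
    · apply Fin.ext
      simp only
      omega
  · intro j hj
    have := Finset.mem_Icc.1 (Finset.mem_def.2 hj)
    simp [WeightedGraph.lam, this]

theorem WeightedGraph.lam_mono {V : Type*} [Fintype V] [DecidableEq V] (G : WeightedGraph V)
    {i j : ℕ} (hi : 1 ≤ i) (hij : i ≤ j) (hj : j ≤ Fintype.card V) : G.lam i ≤ G.lam j := by
  rw [WeightedGraph.lam, WeightedGraph.lam, dif_pos ⟨hi, hij.trans hj⟩, dif_pos ⟨hi.trans hij, hj⟩]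
  refine G.normLaplacian_isHermitian.eigenvalues₀_antitone ?_
  rw [Fin.mk_le_mk]
  omega

/-! ### Numerical estimates for `ε`. -/

theorem three_quarters_le_log : (3 / 4 : ℝ) ≤ Real.log 2.2 := by
  have h : Real.log 2.2 = Real.log 2 + Real.log 1.1 := by
    rw [← Real.log_mul (by norm_num) (by norm_num)]
    norm_num
  have h1 := Real.log_two_gt_d9
  have h2 := Real.one_sub_inv_le_log_of_pos (show (0 : ℝ) < 1.1 by norm_num)
  norm_num at h1 h2 ⊢
  norm_num at h
  linarith

section Noise

variable {k : ℕ} {c : ℝ}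

theorem le_div_of_le_mul_div (h1 : 1 ≤ c) (h2 : c ≤ 10 * k / 22) : 2.2 ≤ k / c := by
  rw [le_div_iff₀ (by linarith)]
  linarith

theorem noise_mul_log (h1 : 1 ≤ c) (h2 : c ≤ 10 * k / 22) :
    noise k c * Real.log (k / c) = Real.log 2.2 := by
  have h := le_div_of_le_mul_div h1 h2
  have hl : 0 < Real.log (k / c) := Real.log_pos (by linarith)
  have h22 : 0 < Real.log 2.2 := by linarith [three_quarters_le_log]
  rw [noise, Real.logb]
  field_simp

theorem noise_le_one (h1 : 1 ≤ c) (h2 : c ≤ 10 * k / 22) : noise k c ≤ 1 := by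
  have h := le_div_of_le_mul_div h1 h2
  have hl : 0 < Real.log (k / c) := Real.log_pos (by linarith)
  have hle : Real.log 2.2 ≤ Real.log (k / c) := Real.log_le_log (by norm_num) h
  rw [← noise_mul_log h1 h2] at hle
  nlinarith

/-- Since `exp 1 * log t ≤ t`, one has `k ≥ k / c ≥ exp 1 * log (k / c)`. Multiplying by `ε` gives
`kε ≥ exp 1 * log 2.2`, which exceeds 2 as `log 2.2 ≥ 3 / 4`. -/
theorem two_le_mul_noise (h1 : 1 ≤ c) (h2 : c ≤ 10 * k / 22) : 2 ≤ k * noise k c := by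
  have h := le_div_of_le_mul_div h1 h2
  have hn := noise_pos h1 h2
  have hx : (0 : ℝ) < k / c := by linarith
  have hexp : Real.exp 1 * Real.log (k / c) ≤ k / c := by
    have := Real.add_one_le_exp (Real.log (k / c) - 1)
    rw [Real.exp_sub, Real.exp_log hx, sub_add_cancel, le_div_iff₀ (Real.exp_pos 1)] at this
    linarith
  have hk : (k : ℝ) / c ≤ k := div_le_self (Nat.cast_nonneg k) h1
  have he := Real.exp_one_gt_d9
  have h34 := three_quarters_le_log
  calc (2 : ℝ) ≤ Real.exp 1 * Real.log 2.2 := by nlinarith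
    _ = noise k c * (Real.exp 1 * Real.log (k / c)) := by rw [← noise_mul_log h1 h2]; ring
    _ ≤ noise k c * k := by gcongr; exact hexp.trans hk
    _ = k * noise k c := mul_comm _ _

theorem div_rpow_noise (h1 : 1 ≤ c) (h2 : c ≤ 10 * k / 22) : (c / k) ^ noise k c = 1 / 2.2 := by
  have h := le_div_of_le_mul_div h1 h2
  rw [← inv_div, Real.inv_rpow (by linarith), Real.rpow_def_of_pos (by linarith), mul_comm,
    noise_mul_log h1 h2, Real.exp_log (by norm_num), one_div]

end Noise

/-- If `m e` is large, then `(1 + e) ^ m` dominates `(1 - e) ^ m`. -/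
theorem mul_one_sub_pow_le_one_add_pow {e s : ℝ} {m : ℕ} (he0 : 0 ≤ e) (he1 : e ≤ 1) (hs : 0 ≤ s)
    (h : s ≤ m * e) : (1 + s) * (1 + s + s ^ 2 / 2) * (1 - e) ^ m ≤ (1 + e) ^ m := by
  have h1 : 1 + s ≤ (1 + e) ^ m := by
    have := one_add_mul_le_pow (show (-2 : ℝ) ≤ e by linarith) m
    linarith
  have h2 : 1 + s + s ^ 2 / 2 ≤ Real.exp (m * e) :=
    (Real.quadratic_le_exp_of_nonneg hs).trans (Real.exp_le_exp.2 h)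
  -- From `1 - e ≤ exp (-e)`, raised to the power `m`.
  have h3 : Real.exp (m * e) * (1 - e) ^ m ≤ 1 := by
    rw [Real.exp_nat_mul, ← mul_pow]
    refine pow_le_one₀ (mul_nonneg (Real.exp_pos e).le (by linarith)) ?_
    have := mul_le_mul_of_nonneg_left (Real.add_one_le_exp (-e)) (Real.exp_pos e).le
    rw [← Real.exp_add, add_neg_cancel, Real.exp_zero] at this
    linarith
  have hb : 0 ≤ (1 - e) ^ m := pow_nonneg (by linarith) m
  calc (1 + s) * (1 + s + s ^ 2 / 2) * (1 - e) ^ m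
      = (1 + s) * ((1 + s + s ^ 2 / 2) * (1 - e) ^ m) := by ring
    _ ≤ (1 + s) * (Real.exp (m * e) * (1 - e) ^ m) := by gcongr
    _ ≤ (1 + s) * 1 := by gcongr
    _ ≤ (1 + e) ^ m := by linarith

/-- In each coordinate, an even number of the three conditions `x i ≠ y i`, `x i ≠ 0`, `y i ≠ 0`
hold. Hence odd distance means opposite parities. -/
theorem even_hammingDist_add {k : ℕ} (x y : Fin k → Fin 2) :
    Even (hammingDist x y + (hammingNorm x + hammingNorm y)) := by
  simp only [hammingDist, hammingNorm, Finset.card_filter, ← Finset.sum_add_distrib]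
  refine Finset.even_sum _ fun i _ => ?_
  generalize x i = a
  generalize y i = b
  fin_cases a <;> fin_cases b <;> simp

theorem walshEigenvalue_zero (k : ℕ) (e : ℝ) :
    walshEigenvalue k e 0 = ((1 + e) ^ k - (1 - e) ^ k) / 2 := by
  simp [walshEigenvalue]

/-! ### Conductance and Laplacian of general weighted graphs. -/

theorem WeightedGraph.weight_nonneg {V : Type*} (G : WeightedGraph V) (x y : V) :
    0 ≤ G.weight x y := by
  by_cases h : G.graph.Adj x y
  · exact (G.weight_pos x y h).le
  · exact (G.weight_eq_zero x y h).ge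

namespace WeightedGraph

variable {V : Type*} [Fintype V] [DecidableEq V] (G : WeightedGraph V)

theorem boundaryWeight_eq (S : Finset V) :
    G.boundaryWeight S = G.stubWeight S - ∑ x ∈ S, ∑ y ∈ S, G.weight x y := by
  rw [boundaryWeight, stubWeight, ← Finset.sum_sub_distrib]
  refine Finset.sum_congr rfl fun x _ => ?_
  rw [degree, ← Finset.sum_add_sum_compl S]
  ring

theorem stubWeight_nonneg (S : Finset V) : 0 ≤ G.stubWeight S :=
  Finset.sum_nonneg fun x _ => Finset.sum_nonneg fun y _ => G.weight_nonneg x y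

theorem insideWeight_nonneg (S S' : Finset V) : 0 ≤ G.insideWeight S S' := by
  refine Finset.sum_nonneg fun x _ => Finset.sum_nonneg fun y _ => ?_
  split_ifs
  · exact G.weight_nonneg x y
  · exact le_rfl

theorem conductance_union_le_bipartiteConductance (S S' : Finset V) :
    G.conductance (S ∪ S') ≤ G.bipartiteConductance S S' :=
  div_le_div_of_nonneg_right (le_add_of_nonneg_right (G.insideWeight_nonneg S S'))
    (G.stubWeight_nonneg _)

/-- For a regular graph the normalized Laplacian is `1 - A / d`. -/
theorem normLaplacian_mulVec {d : ℝ} (hd : 0 < d) (hG : ∀ x, G.degree x = d) {f : V → ℝ} {r : ℝ}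
    (hf : G.adjMatrix.mulVec f = r • f) : G.normLaplacian.mulVec f = (1 - r / d) • f := by
  have h1 : G.invSqrtDegMatrix = (√d)⁻¹ • 1 := by
    simp only [invSqrtDegMatrix, hG]
    rw [Matrix.smul_one_eq_diagonal]
  have h2 : Matrix.diagonal G.degree = d • (1 : Matrix V V ℝ) := by
    rw [Matrix.smul_one_eq_diagonal]
    congr 1
    exact funext hG
  rw [normLaplacian, h1, h2, Matrix.smul_mul, Matrix.one_mul, Matrix.mul_smul, Matrix.mul_one,
    smul_smul, ← mul_inv, Real.mul_self_sqrt hd.le, Matrix.smul_mulVec, Matrix.sub_mulVec, hf,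
    Matrix.smul_mulVec, Matrix.one_mulVec, ← sub_smul, smul_smul]
  congr 1
  field_simp

end WeightedGraph

/-- If more than `k` of the entries of an increasing list are at least `v`, then so is
the `k + 1`-st entry from the end. -/
theorem le_of_card_filter_le {ι : Type*} [Fintype ι] {n k : ℕ} {f : ℕ → ℝ} {μ : ι → ℝ} {v : ℝ}
    (hf : ∀ i j, 1 ≤ i → i ≤ j → j ≤ n → f i ≤ f j) (hkn : k < n)
    (h : (Finset.Icc 1 n).val.map f = (Finset.univ : Finset ι).val.map μ)
    (hcard : k + 1 ≤ (Finset.univ.filter fun i => v ≤ μ i).card) : v ≤ f (n - k) := by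
  by_contra! hv
  have hc := congrArg (Multiset.countP fun t => v ≤ t) h
  rw [Multiset.countP_map, Multiset.countP_map] at hc
  have hsub : (Finset.Icc 1 n).filter (fun j => v ≤ f j) ⊆ Finset.Icc (n - k + 1) n := by
    intro j hj
    rw [Finset.mem_filter, Finset.mem_Icc] at hj
    rw [Finset.mem_Icc]
    refine ⟨?_, hj.1.2⟩
    by_contra! hlt
    have := hf j (n - k) hj.1.1 (by omega) (by omega)
    linarith [hj.2]
  have hle := Finset.card_le_card hsub
  rw [Nat.card_Icc] at hle
  change ((Finset.Icc 1 n).filter (fun j => v ≤ f j)).card =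
    (Finset.univ.filter fun i => v ≤ μ i).card at hc
  omega

/-! ### The bipartite noisy hypercube. -/

namespace BipartiteNoisyHypercube

variable {k : ℕ} {c : ℝ} (h1 : 1 ≤ c) (h2 : c ≤ 10 * k / 22)

theorem weight_eq (x y : Fin k → Fin 2) :
    (bipartiteNoisyHypercube k c h1 h2).weight x y =
      (noise k c ^ hammingDist x y - (-noise k c) ^ hammingDist x y) / 2 := by
  change (if Odd (hammingDist x y) then noise k c ^ hammingDist x y else 0) = _
  split_ifs with h
  · rw [h.neg_pow]; ring
  · rw [(Nat.not_odd_iff_even.1 h).neg_pow]; ring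

theorem adj_iff (x y : Fin k → Fin 2) : (bipartiteNoisyHypercube k c h1 h2).graph.Adj x y ↔
    (Even (hammingNorm x) ↔ Odd (hammingNorm y)) := by
  change Odd (hammingDist x y) ↔ _
  have h := even_hammingDist_add x y
  grind

theorem adjMatrix_mulVec_walsh (S : Finset (Fin k)) :
    (bipartiteNoisyHypercube k c h1 h2).adjMatrix.mulVec (walsh S) =
      walshEigenvalue k (noise k c) S.card • walsh S := by
  ext x
  have hp := sum_pow_hammingDist_mul_walsh (noise k c) S x
  have hm := sum_pow_hammingDist_mul_walsh (-noise k c) S x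
  simp only [Matrix.mulVec, dotProduct, WeightedGraph.adjMatrix, Matrix.of_apply, weight_eq,
    Pi.smul_apply, smul_eq_mul, walshEigenvalue]
  have : ∀ y, (noise k c ^ hammingDist x y - (-noise k c) ^ hammingDist x y) / 2 * walsh S y =
      (noise k c ^ hammingDist x y * walsh S y - (-noise k c) ^ hammingDist x y * walsh S y) / 2 :=
    fun y => by ring
  simp_rw [this]
  rw [← Finset.sum_div, Finset.sum_sub_distrib, hp, hm]
  ring

theorem degree_eq (x : Fin k → Fin 2) : (bipartiteNoisyHypercube k c h1 h2).degree x =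
    ((1 + noise k c) ^ k - (1 - noise k c) ^ k) / 2 := by
  have h := congrFun (adjMatrix_mulVec_walsh h1 h2 (∅ : Finset (Fin k))) x
  simpa [Matrix.mulVec, dotProduct, walsh, WeightedGraph.adjMatrix, walshEigenvalue_zero,
    WeightedGraph.degree] using h

/-- With `s = 2` the general estimate gives the factor 15. The weaker 11 is exactly what yields `d ≥
(1 + ε) ^ k / 2.2`. -/
theorem eleven_mul_pow_le (h1 : 1 ≤ c) (h2 : c ≤ 10 * k / 22) :
    11 * (1 - noise k c) ^ k ≤ (1 + noise k c) ^ k := by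
  have h := mul_one_sub_pow_le_one_add_pow (noise_pos h1 h2).le (noise_le_one h1 h2) zero_le_two
    (two_le_mul_noise h1 h2)
  have hb : 0 ≤ (1 - noise k c) ^ k := pow_nonneg (by linarith [noise_le_one h1 h2]) k
  linarith

theorem degree_pos (h1 : 1 ≤ c) (h2 : c ≤ 10 * k / 22) :
    0 < ((1 + noise k c) ^ k - (1 - noise k c) ^ k) / 2 := by
  have h := eleven_mul_pow_le h1 h2
  have hb : 0 ≤ (1 - noise k c) ^ k := pow_nonneg (by linarith [noise_le_one h1 h2]) k
  have ha : 0 < (1 + noise k c) ^ k := pow_pos (by linarith [noise_pos h1 h2]) k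
  linarith

theorem map_lam_eq :
    (Finset.Icc 1 (2 ^ k)).val.map (bipartiteNoisyHypercube k c h1 h2).lam =
      (Finset.univ : Finset (Finset (Fin k))).val.map fun S =>
        1 - walshEigenvalue k (noise k c) S.card /
          (((1 + noise k c) ^ k - (1 - noise k c) ^ k) / 2) := by
  have h := (bipartiteNoisyHypercube k c h1 h2).map_lam
  rw [Fintype.card_fun, Fintype.card_fin, Fintype.card_fin] at h
  rw [h]
  exact roots_charpoly_of_walsh _ _ fun S =>
    WeightedGraph.normLaplacian_mulVec _ (degree_pos h1 h2) (degree_eq h1 h2)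
      (adjMatrix_mulVec_walsh h1 h2 S)

theorem two_sub_le_eigenvalue (h1 : 1 ≤ c) (h2 : c ≤ 10 * k / 22) {i : ℕ} (hi : i ≤ k)
    (hki : k ≤ i + 1) :
    2 - 3 * noise k c ≤ 1 - walshEigenvalue k (noise k c) i /
      (((1 + noise k c) ^ k - (1 - noise k c) ^ k) / 2) := by
  have hd := degree_pos h1 h2
  have he0 := noise_pos h1 h2
  have he1 := noise_le_one h1 h2
  have hke := two_le_mul_noise h1 h2
  set e := noise k c
  obtain ⟨m, rfl⟩ : ∃ m, k = m + 1 := ⟨k - 1, by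
    have : k ≠ 0 := by rintro rfl; norm_num at hke
    omega⟩
  push_cast at hke
  -- Here `m * e = k * e - e ≥ 2 - 1`, so `s = 1` is allowed and gives the factor `2 * 2.5 = 5`.
  have hpow := mul_one_sub_pow_le_one_add_pow (m := m) he0.le he1 zero_le_one (by linarith)
  have hb : 0 ≤ (1 - e) ^ m := pow_nonneg (by linarith) m
  have ha : 0 ≤ (1 + e) ^ m := pow_nonneg (by linarith) m
  suffices h : walshEigenvalue (m + 1) e i ≤
      (3 * e - 1) * (((1 + e) ^ (m + 1) - (1 - e) ^ (m + 1)) / 2) by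
    have := (div_le_iff₀ hd).2 h
    linarith
  have h5 : 5 * (1 - e) ^ m ≤ (1 + e) ^ m := by linarith
  obtain rfl | rfl : i = m ∨ i = m + 1 := by omega
  · rw [walshEigenvalue, Nat.add_sub_cancel_left, pow_one, pow_one, pow_succ, pow_succ]
    generalize (1 - e) ^ i = Y at *
    generalize (1 + e) ^ i = X at *
    -- This is twice the difference of the two sides of the goal.
    have h' : 0 ≤ e * ((X - 5 * Y) + 3 * e * X + 3 * e * Y) := 
      mul_nonneg he0.le (by nlinarith [mul_nonneg he0.le ha, mul_nonneg he0.le hb])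
    linarith
  · rw [walshEigenvalue, Nat.sub_self, pow_zero, pow_zero]
    nlinarith

/-- The full set and the `k` sets of size `k - 1` supply `k + 1` eigenvalues that are at least `2 -
3ε`, one more than the `k` positions above `n - k`. -/
theorem two_sub_lam_le :
    2 - (bipartiteNoisyHypercube k c h1 h2).lam (2 ^ k - k) ≤ 3 * noise k c := by
  have h := le_of_card_filter_le (v := 2 - 3 * noise k c) (n := 2 ^ k) (k := k)
    (f := (bipartiteNoisyHypercube k c h1 h2).lam) ?_ Nat.lt_two_pow_self
    (map_lam_eq h1 h2) ?_
  · linarith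
  · intro i j hi hij hj
    exact WeightedGraph.lam_mono _ hi hij (by simpa using hj)
  · have hk : 1 ≤ k := by
      by_contra! h0
      obtain rfl : k = 0 := by omega
      norm_num at h2
      linarith
    have hsub : insert Finset.univ (Finset.powersetCard (k - 1) Finset.univ) ⊆
        Finset.univ.filter fun S : Finset (Fin k) => 2 - 3 * noise k c ≤
          1 - walshEigenvalue k (noise k c) S.card /
            (((1 + noise k c) ^ k - (1 - noise k c) ^ k) / 2) := by
      intro S hS
      rw [Finset.mem_insert, Finset.mem_powersetCard] at hS
      rw [Finset.mem_filter]
      refine ⟨Finset.mem_univ _, two_sub_le_eigenvalue h1 h2 (by simpa using S.card_le_univ) ?_⟩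
      rcases hS with rfl | ⟨-, hS⟩
      · simp
      · omega
    refine le_trans (le_of_eq ?_) (Finset.card_le_card hsub)
    rw [Finset.card_insert_of_notMem (by rw [Finset.mem_powersetCard]; simp; omega),
      Finset.card_powersetCard, Finset.card_univ, Fintype.card_fin,
      ← Nat.choose_symm (by omega : k - 1 ≤ k), Nat.sub_sub_self hk, Nat.choose_one_right]

theorem half_le_conductance {T : Finset (Fin k → Fin 2)} (hT : T.Nonempty)
    (hc : (T.card : ℝ) ≤ c / k * 2 ^ k) :
    1 / 2 ≤ (bipartiteNoisyHypercube k c h1 h2).conductance T := by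
  have hd := degree_pos h1 h2
  have he0 := noise_pos h1 h2
  have he1 := noise_le_one h1 h2
  have hpow := eleven_mul_pow_le h1 h2
  have hdiv := div_rpow_noise h1 h2
  have hT0 : (0 : ℝ) < T.card := by exact_mod_cast hT.card_pos
  have hck : 0 ≤ c / k := by positivity
  have hstub : (bipartiteNoisyHypercube k c h1 h2).stubWeight T =
      T.card * (((1 + noise k c) ^ k - (1 - noise k c) ^ k) / 2) := by
    simp [WeightedGraph.stubWeight, degree_eq]
  have hin : ∑ x ∈ T, ∑ y ∈ T, (bipartiteNoisyHypercube k c h1 h2).weight x y ≤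
      ((1 + noise k c) * 2 ^ (-noise k c)) ^ k * (T.card : ℝ) ^ (1 + noise k c) / 2 := by
    have hp := noiseForm_indicator_le he0.le he1 T
    have hm := noiseForm_neg_indicator_nonneg he0.le he1 T
    -- The form with parameter `-ε` enters with a minus sign and is nonnegative, so it can be
    -- dropped.
    simp only [weight_eq, ← Finset.sum_div, Finset.sum_sub_distrib]
    linarith
  have hsmall : ((2 : ℝ) ^ (-noise k c)) ^ k * (T.card : ℝ) ^ noise k c ≤ 1 / 2.2 := by
    have h2k : ((2 : ℝ) ^ (-noise k c)) ^ k = (2 ^ k) ^ (-noise k c) := by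
      rw [← Real.rpow_natCast, ← Real.rpow_natCast, ← Real.rpow_mul zero_le_two,
        ← Real.rpow_mul zero_le_two, mul_comm]
    rw [← hdiv, h2k]
    calc ((2 : ℝ) ^ k) ^ (-noise k c) * (T.card : ℝ) ^ noise k c
        ≤ ((2 : ℝ) ^ k) ^ (-noise k c) * (c / k * 2 ^ k) ^ noise k c := by gcongr
      _ = (c / k) ^ noise k c := by
        rw [Real.mul_rpow hck (by positivity), mul_left_comm, ← Real.rpow_add (by positivity),
          neg_add_cancel, Real.rpow_zero, mul_one]
  have ha : 0 ≤ (1 + noise k c) ^ k := by positivity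
  have hin' : ((1 + noise k c) * 2 ^ (-noise k c)) ^ k * (T.card : ℝ) ^ (1 + noise k c) ≤
      T.card * ((1 + noise k c) ^ k * (1 / 2.2)) := by
    rw [Real.rpow_add hT0, Real.rpow_one, mul_pow]
    calc _ = T.card * ((1 + noise k c) ^ k *
          (((2 : ℝ) ^ (-noise k c)) ^ k * (T.card : ℝ) ^ noise k c)) := by ring
      _ ≤ _ := by gcongr
  rw [WeightedGraph.conductance, WeightedGraph.boundaryWeight_eq, hstub,
    le_div_iff₀ (mul_pos hT0 hd)]
  -- The inside weight is at most `|T| * (1 + ε) ^ k / 4.4`, and `hpow` says that this is at most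
  -- half of `d * |T|`.
  have hfin := mul_le_mul_of_nonneg_left hpow hT0.le
  norm_num at hin'
  linarith

theorem half_le_bipartiteConductance {T T' : Finset (Fin k → Fin 2)} (hT : (T ∪ T').Nonempty)
    (hc : ((T ∪ T').card : ℝ) ≤ c / k * 2 ^ k) :
    1 / 2 ≤ (bipartiteNoisyHypercube k c h1 h2).bipartiteConductance T T' :=
  (half_le_conductance h1 h2 hT hc).trans
    (WeightedGraph.conductance_union_le_bipartiteConductance _ T T')

/-- Among at least `k / c` disjoint sets one is small. -/
theorem exists_card_le (h1 : 1 ≤ c) (h2 : c ≤ 10 * k / 22) {r : ℕ} (hr : (k : ℝ) / c ≤ r)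
    (U : Fin r → Finset (Fin k → Fin 2)) (hU : Pairwise fun i j => Disjoint (U i) (U j)) :
    ∃ i, ((U i).card : ℝ) ≤ c / k * 2 ^ k := by
  have hkc := le_div_of_le_mul_div h1 h2
  have hc0 : 0 < c := by linarith
  have hk0 : (0 : ℝ) < k := by linarith
  have hr0 : (0 : ℝ) < r := by linarith
  by_contra! h
  have hsum : ∑ i, ((U i).card : ℝ) ≤ 2 ^ k := by
    have := Finset.card_le_univ (Finset.univ.biUnion U)
    rw [Finset.card_biUnion fun i _ j _ hij => hU hij] at this
    simp only [Fintype.card_fun, Fintype.card_fin] at this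
    exact_mod_cast this
  have hlt : ∑ _i : Fin r, c / k * 2 ^ k < ∑ i, ((U i).card : ℝ) :=
    Finset.sum_lt_sum_of_nonempty ⟨⟨0, by exact_mod_cast hr0⟩, Finset.mem_univ _⟩ fun i _ => h i
  rw [Finset.sum_const, Finset.card_univ, Fintype.card_fin, nsmul_eq_mul] at hlt
  have : 1 ≤ r * (c / k) := by
    calc (1 : ℝ) = k / c * (c / k) := by field_simp
      _ ≤ _ := by gcongr
  nlinarith [pow_pos (two_pos : (0 : ℝ) < 2) k]

/-- For fixed `c` the noise is at most a constant multiple of `1 / log k`. -/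
theorem log_mul_noise_le (h1 : 1 ≤ c) (h2 : c ≤ 10 * k / 22) :
    Real.log k * noise k c ≤ Real.log 2.2 + Real.log c := by
  have hkc := le_div_of_le_mul_div h1 h2
  have hc0 : 0 < c := by linarith
  have hk0 : (0 : ℝ) < k := by linarith
  have h := noise_mul_log h1 h2
  have hlc := Real.log_nonneg h1
  have he1 := noise_le_one h1 h2
  rw [Real.log_div hk0.ne' hc0.ne'] at h
  nlinarith

theorem sharpness {r : ℕ} (hr : (k : ℝ) / c ≤ r) (T T' : Fin r → Finset (Fin k → Fin 2))
    (hne : ∀ i, (T i ∪ T' i).Nonempty)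
    (hdisj : Pairwise fun i j => Disjoint (T i ∪ T' i) (T j ∪ T' j)) {B : ℝ}
    (hB : ∀ i, (bipartiteNoisyHypercube k c h1 h2).bipartiteConductance (T i) (T' i) ≤
      B * √(2 - (bipartiteNoisyHypercube k c h1 h2).lam (2 ^ k + 1 - k))) :
    (√(12 * (Real.log 2.2 + Real.log c)))⁻¹ * √(Real.log k) ≤ B := by
  obtain ⟨i, hi⟩ := exists_card_le h1 h2 hr _ hdisj
  have hhalf := (half_le_bipartiteConductance h1 h2 (hne i) hi).trans (hB i)
  have hk2 : k < 2 ^ k := Nat.lt_two_pow_self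
  have hk1 : 1 ≤ k := by
    by_contra! h0
    obtain rfl : k = 0 := by omega
    norm_num at h2
    linarith
  have hlam : (bipartiteNoisyHypercube k c h1 h2).lam (2 ^ k - k) ≤
      (bipartiteNoisyHypercube k c h1 h2).lam (2 ^ k + 1 - k) :=
    WeightedGraph.lam_mono _ (by omega) (by omega) (by simp; omega)
  have h3 := two_sub_lam_le h1 h2
  have hs : √(2 - (bipartiteNoisyHypercube k c h1 h2).lam (2 ^ k + 1 - k)) ≤
      √(3 * noise k c) := Real.sqrt_le_sqrt (by linarith)
  have hB0 : 0 < B := by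
    by_contra! hneg
    nlinarith [Real.sqrt_nonneg (2 - (bipartiteNoisyHypercube k c h1 h2).lam (2 ^ k + 1 - k))]
  have hhalf' : 1 / 2 ≤ B * √(3 * noise k c) := hhalf.trans (by gcongr)
  have he0 := noise_pos h1 h2
  -- Squaring `1 / 2 ≤ B * √(3ε)` produces the 12 in the constant; the rest of the constant bounds
  -- `ε * log k`.
  have hsq : 1 ≤ 12 * noise k c * B ^ 2 := by
    have := pow_le_pow_left₀ (by norm_num) hhalf' 2
    rw [mul_pow, Real.sq_sqrt (by positivity)] at this
    linarith
  have hL : 0 < Real.log 2.2 + Real.log c := by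
    linarith [three_quarters_le_log, Real.log_nonneg h1]
  rw [inv_mul_le_iff₀ (Real.sqrt_pos.2 (by linarith))]
  refine Real.sqrt_le_iff.2 ⟨by positivity, ?_⟩
  rw [mul_pow, Real.sq_sqrt (by linarith)]
  have hlk : 0 ≤ Real.log k := Real.log_nonneg (by exact_mod_cast hk1)
  have h4 := mul_le_mul_of_nonneg_left hsq hlk
  have h5 := mul_le_mul_of_nonneg_right (log_mul_noise_le h1 h2) (sq_nonneg B)
  linarith

end BipartiteNoisyHypercube

theorem mainTheorem4 :
    (∀ (k : ℕ) (c : ℝ) (h1 : 1 ≤ c) (h2 : c ≤ 10 * k / 22),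
      -- the graph is regular of positive degree
      (∀ x, 0 < (bipartiteNoisyHypercube k c h1 h2).degree x ∧
        (bipartiteNoisyHypercube k c h1 h2).degree x =
          ((1 + noise k c) ^ k - (1 - noise k c) ^ k) / 2) ∧
      -- it is complete bipartite, the sides being the points of even and of odd weight
      (∀ x y, (bipartiteNoisyHypercube k c h1 h2).graph.Adj x y ↔
        (Even (hammingNorm x) ↔ Odd (hammingNorm y))) ∧
      -- Walsh functions are eigenfunctions of the adjacency operator
      (∀ S : Finset (Fin k),
        (bipartiteNoisyHypercube k c h1 h2).adjMatrix.mulVec (walsh S) =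
          walshEigenvalue k (noise k c) S.card • walsh S) ∧
      -- the spectrum of the normalized Laplacian, with multiplicities
      ((Finset.Icc 1 (2 ^ k)).val.map (bipartiteNoisyHypercube k c h1 h2).lam =
        (Finset.univ : Finset (Finset (Fin k))).val.map fun S =>
          1 - walshEigenvalue k (noise k c) S.card /
            (((1 + noise k c) ^ k - (1 - noise k c) ^ k) / 2)) ∧
      -- the eigenvalue bound, with `n = 2 ^ k`
      2 - (bipartiteNoisyHypercube k c h1 h2).lam (2 ^ k - k) ≤ 3 * noise k c ∧
      -- small sets have large conductance
      (∀ T : Finset (Fin k → Fin 2), T.Nonempty → (T.card : ℝ) ≤ c / k * 2 ^ k →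
        1 / 2 ≤ (bipartiteNoisyHypercube k c h1 h2).conductance T) ∧
      -- small pairs have large bipartite conductance
      (∀ T T' : Finset (Fin k → Fin 2), (T ∪ T').Nonempty →
        ((T ∪ T').card : ℝ) ≤ c / k * 2 ^ k →
        1 / 2 ≤ (bipartiteNoisyHypercube k c h1 h2).bipartiteConductance T T')) ∧
    -- sharpness: the factor `√(log k)` in the bound for `r ≥ k / c` communities is necessary
    (∀ (c : ℝ) (h1 : 1 ≤ c), ∃ K : ℝ, 0 < K ∧
      ∀ (k : ℕ) (h2 : c ≤ 10 * k / 22) (r : ℕ), (k : ℝ) / c ≤ r →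
      ∀ (T T' : Fin r → Finset (Fin k → Fin 2)),
        (∀ i, (T i ∪ T' i).Nonempty) →
        (Pairwise fun i j => Disjoint (T i ∪ T' i) (T j ∪ T' j)) →
        ∀ B : ℝ,
          (∀ i, (bipartiteNoisyHypercube k c h1 h2).bipartiteConductance (T i) (T' i) ≤
            B * √(2 - (bipartiteNoisyHypercube k c h1 h2).lam (2 ^ k + 1 - k))) →
          K * √(Real.log k) ≤ B) := by
  refine ⟨fun k c h1 h2 => ⟨fun x => ?_, BipartiteNoisyHypercube.adj_iff h1 h2,
    BipartiteNoisyHypercube.adjMatrix_mulVec_walsh h1 h2, BipartiteNoisyHypercube.map_lam_eq h1 h2,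
    BipartiteNoisyHypercube.two_sub_lam_le h1 h2,
    fun T => BipartiteNoisyHypercube.half_le_conductance h1 h2,
    fun T T' => BipartiteNoisyHypercube.half_le_bipartiteConductance h1 h2⟩,
    fun c h1 => ⟨(√(12 * (Real.log 2.2 + Real.log c)))⁻¹, ?_, fun k h2 r hr T T' hne hdisj B hB =>
      BipartiteNoisyHypercube.sharpness h1 h2 hr T T' hne hdisj hB⟩⟩
  · have h := BipartiteNoisyHypercube.degree_eq h1 h2 x
    exact ⟨h ▸ BipartiteNoisyHypercube.degree_pos h1 h2, h⟩
  · have := three_quarters_le_log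
    have := Real.log_nonneg h1
    positivity
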